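/- Let $d_0\ge 1$, let $p_1,\dots,p_{d_0}\ge 0$ with $\sum_d p_d=1$, and for each $1\le d\le d_0$ let $\zeta_{1,d},\dots,\zeta_{d,d}\ge 0$ with $\sum_{k=1}^d\zeta_{k,d}=1$. Let $q$ be a continuous, compactly supported probability density on $\mathbb R$. Consider a branching random walk started from one particle at $0$, in which every particle $v$ has a random number $d(v)$ of children with $\mathbb P[d(v)=d]=p_d$ for $1\le d\le d_0$, and every child is displaced from its parent by an increment with density $q$. Attach to every particle $v$ a random threshold $L_v\in\{1,\dots,d(v)\}$ with $\mathbb P[L_v=k\mid d(v)=d]=\zeta_{k,d}$. The pairs $(d(v),L_v)$ and the increments are all independent. For $n\ge 0$ assign to each particle of generation $n$ its position, and then, generation by generation towards the root, assign to each particle $v$ of generation less than $n$ the $L_v$-th smallest of the values assigned to its children. Let $M_n$ be the value assigned in this way to the root. Set $$g(x)=\sum_{d=1}^{d_0}\sum_{k=1}^d p_d\,\zeta_{k,d}\sum_{l=k}^d\binom dl x^l(1-x)^{d-l},\qquad f(u)=g(u)-u,$$ and assume $f\not\equiv 0$. Let $N_f$ be the number of zeros of $f$ in $(0,1)$ and let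 $0=\alpha_0<\alpha_1<\dots<\alpha_{N_f+1}=1$ be the zeros of $f$ in $[0,1]$. For $0\le s\le N_f+1$ and $n\ge 0$ let $q_{s,n}\in[-\infty,\infty]$ be any $\alpha_s$-quantile of $M_n$, that is, $\mathbb P[M_n<q_{s,n}]\le\alpha_s\le\mathbb P[M_n\le q_{s,n}]$, and let $I_{s,n}=\mathbb{R}\cap[q_{s-1,n},q_{s,n}]$ for $1\le s\le N_f+1$. Then for every $s\in\{1,\dots,N_f+1\}$ we have $\mathbb P[M_n\in I_{s,n}]>0$ for all $n$, and if $M_{n;I_{s,n}}$ denotes a random variable whose law is the conditional law of $M_n$ given $M_n\in I_{s,n}$, and $\mathrm{med}(M_{n;I_{s,n}})$ any median of it, then the sequence $\big(M_{n;I_{s,n}}-\mathrm{med}(M_{n;I_{s,n}})\big)_{n\ge 0}$ is tight. -/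

import Mathlib

open MeasureTheory ProbabilityTheory

noncomputable section

/-- The parameters `(p_d, ζ_{k,d})`, `1 ≤ k ≤ d ≤ d₀`, of a random threshold voting model:
an offspring law on `{1, …, d₀}` and, for every `d`, a law on the thresholds `{1, …, d}`.
Only the values at `1 ≤ k ≤ d ≤ d₀` matter; `ζ k d` stands for `ζ_{k,d}`. -/
structure ThresholdModel where
  d₀ : ℕ
  p : ℕ → ℝ
  ζ : ℕ → ℕ → ℝ
  p_nonneg : ∀ d ∈ Finset.Icc 1 d₀, 0 ≤ p d
  p_sum : ∑ d ∈ Finset.Icc 1 d₀, p d = 1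
  ζ_nonneg : ∀ d ∈ Finset.Icc 1 d₀, ∀ k ∈ Finset.Icc 1 d, 0 ≤ ζ k d
  ζ_sum : ∀ d ∈ Finset.Icc 1 d₀, ∑ k ∈ Finset.Icc 1 d, ζ k d = 1

namespace ThresholdModel

/-- The recursion polynomial `g`. -/
def recursionPoly (V : ThresholdModel) (x : ℝ) : ℝ :=
  ∑ d ∈ Finset.Icc 1 V.d₀, ∑ k ∈ Finset.Icc 1 d,
    V.p d * V.ζ k d * ∑ l ∈ Finset.Icc k d, (d.choose l : ℝ) * x ^ l * (1 - x) ^ (d - l)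

/-- The nonlinearity `f(u) = g(u) - u`. -/
def nonlinearity (V : ThresholdModel) (u : ℝ) : ℝ :=
  V.recursionPoly u - u

/-- `N_f`, the number of zeros of the nonlinearity in the open interval `(0, 1)`. -/
def numZeros (V : ThresholdModel) : ℕ :=
  Set.ncard {u : ℝ | u ∈ Set.Ioo (0 : ℝ) 1 ∧ V.nonlinearity u = 0}

end ThresholdModel

/-- A continuous, compactly supported probability density on the line. -/
structure IsJumpDensity (q : ℝ → ℝ) : Prop where
  continuous : Continuous q
  hasCompactSupport : HasCompactSupport q
  nonneg : ∀ x, 0 ≤ q x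
  integral_eq_one : ∫ x, q x = 1

/-- `orderStat k s` is `s_{(k)}`, the `k`-th element of `s` in increasing order, `1 ≤ k ≤ card s`
(other `k` do not occur in a vote, up to null events). -/
def orderStat (k : ℕ) (s : Multiset ℝ) : ℝ :=
  (s.sort (· ≤ ·)).getD (k - 1) 0

section Voting

variable {Ω : Type*}

/-- Position of the vertex `v` of a branching random walk started at `0`. Vertices are Ulam–Harris
labels: `[]` is the root, the children of `v` are `i :: v` with `i < d(v)`, and `X v` is the
displacement of `v` from its parent. -/
def brwPosition (X : List ℕ → Ω → ℝ) : List ℕ → Ω → ℝ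
  | [], _ => 0
  | i :: v, ω => brwPosition X v ω + X (i :: v) ω

/-- The value propagated to the vertex `v` when voting starts `h` generations below `v`: for `h = 0`
it is the position of `v`, otherwise it is the `L_v`-th smallest of the values at the
`d(v)` children of `v`. -/
def voteValue (d L : List ℕ → Ω → ℕ) (X : List ℕ → Ω → ℝ) : ℕ → List ℕ → Ω → ℝ
  | 0, v, ω => brwPosition X v ω
  | h + 1, v, ω =>
      orderStat (L v ω) ((Multiset.range (d v ω)).map fun i => voteValue d L X h (i :: v) ω)

/-- The outcome `M_n` of the vote: the value at the root when generation `n` votes first. -/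
def voteOutcome (d L : List ℕ → Ω → ℕ) (X : List ℕ → Ω → ℝ) (n : ℕ) (ω : Ω) : ℝ :=
  voteValue d L X n [] ω

/-- `d`, `L`, `X` are the offspring numbers, the thresholds and the displacements of a branching
random walk with offspring law `p_d`, jump density `q` and random threshold voting: over different
vertices everything is independent, at a vertex `X_v` is independent of `(d(v), L_v)`,
`P[d(v) = d, L_v = k] = p_d ζ_{k,d}`, and `X_v` has density `q`. -/
structure IsThresholdVoting [MeasurableSpace Ω] (P : Measure Ω) (V : ThresholdModel) (q : ℝ → ℝ)
    (d L : List ℕ → Ω → ℕ) (X : List ℕ → Ω → ℝ) : Prop where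
  measurable_d : ∀ v, Measurable (d v)
  measurable_L : ∀ v, Measurable (L v)
  measurable_X : ∀ v, Measurable (X v)
  indep_vertices : iIndepFun (fun v ω => ((d v ω, L v ω), X v ω)) P
  indep_displacement : ∀ v, IndepFun (fun ω => (d v ω, L v ω)) (X v) P
  law_threshold : ∀ v, ∀ e ∈ Finset.Icc 1 V.d₀, ∀ k ∈ Finset.Icc 1 e,
    P {ω | d v ω = e ∧ L v ω = k} = ENNReal.ofReal (V.p e * V.ζ k e)
  law_displacement : ∀ v, P.map (X v) = volume.withDensity fun x => ENNReal.ofReal (q x)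

end Voting

/-- `x` is an `α`-quantile of `μ`: `μ (-∞, x) ≤ α ≤ μ (-∞, x]`. Extended real values allow
`-∞` as a `0`-quantile and `+∞` as a `1`-quantile; for `0 < α < 1` quantiles of a probability
measure are real. -/
def IsQuantile (μ : Measure ℝ) (α : ℝ) (x : EReal) : Prop :=
  μ {y : ℝ | (y : EReal) < x} ≤ ENNReal.ofReal α ∧
    ENNReal.ofReal α ≤ μ {y : ℝ | (y : EReal) ≤ x}

/-- The real points of the closed interval with (possibly infinite) endpoints `a` and `b`. -/
def realIcc (a b : EReal) : Set ℝ :=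
  {y : ℝ | a ≤ (y : EReal) ∧ (y : EReal) ≤ b}

end

/-!
The displacements are almost surely bounded by some `R`, so the distribution functions `F n` of the
outcomes satisfy both `F n (x - R) ≤ F (n + 1) x ≤ F n (x + R)` and
`g (F n (x - R)) ≤ F (n + 1) x ≤ g (F n (x + R))`. Eliminating `F (n + 1)` leaves
`g (F n x) ≤ F n (x + 2 * R)` and `F n (x - 2 * R) ≤ g (F n x)`. Between two consecutive zeros
`a < b` of `f`, the function `f` has constant sign and is bounded away from `0` on
`[a + η, b - η]`, so a bounded number of steps of length `2 * R` makes `F n` climb from `a + η` to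
`b - η`: within a distance `K` that does not depend on `n`. As the outcomes of later generations
have no atoms, the law conditioned between an `a`- and a `b`-quantile then puts mass at most
`2 * η / (b - a)` outside the interval of radius `K + 1` about its median.
-/

/-! ### Order statistics -/

section OrderStat

theorem getElem_le_iff_lt_countP {α : Type*} [LinearOrder α] {l : List α}
    (hl : l.Pairwise (· ≤ ·)) {k : ℕ} (hk : k < l.length) (x : α) :
    l[k] ≤ x ↔ k < l.countP (· ≤ x) := by
  induction l generalizing k with
  | nil => simp at hk
  | cons a t ih =>
    rw [List.pairwise_cons] at hl
    by_cases hax : a ≤ x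
    · cases k with
      | zero => simp [hax]
      | succ k => simp [hax, ← ih hl.2 (Nat.lt_of_succ_lt_succ hk)]
    · have hlt : ∀ b ∈ a :: t, x < b := by
        rintro b (_ | ⟨_, hb⟩)
        exacts [not_le.1 hax, (not_le.1 hax).trans_le (hl.1 b hb)]
      have hcount : (a :: t).countP (· ≤ x) = 0 :=
        List.countP_eq_zero.2 fun b hb => by simpa using hlt b hb
      simp only [hcount, not_lt_zero, iff_false, not_le]
      exact hlt _ (List.getElem_mem hk)

variable {k : ℕ} {s : Multiset ℝ}

theorem orderStat_eq_getElem (hk : k - 1 < (s.sort (· ≤ ·)).length) :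
    orderStat k s = (s.sort (· ≤ ·))[k - 1] :=
  List.getD_eq_getElem _ _ hk

theorem orderStat_le_iff (hk : k ∈ Finset.Icc 1 s.card) (x : ℝ) :
    orderStat k s ≤ x ↔ k ≤ s.countP (· ≤ x) := by
  rw [Finset.mem_Icc] at hk
  rw [orderStat_eq_getElem (by rw [Multiset.length_sort]; omega),
    getElem_le_iff_lt_countP (s.pairwise_sort _), ← Multiset.coe_countP, Multiset.sort_eq]
  omega

theorem orderStat_mem (hk : k ∈ Finset.Icc 1 s.card) : orderStat k s ∈ s := by
  rw [Finset.mem_Icc] at hk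
  rw [orderStat_eq_getElem (by rw [Multiset.length_sort]; omega), ← Multiset.mem_sort (· ≤ ·)]
  exact List.getElem_mem _

theorem orderStat_eq_zero (h : s.card ≤ k - 1) : orderStat k s = 0 :=
  List.getD_eq_default _ _ (by rwa [Multiset.length_sort])

variable {ι : Type*} {t : Multiset ι} {a b : ι → ℝ} {c : ℝ}

theorem orderStat_map_le_add (hk : k ∈ Finset.Icc 1 t.card) (h : ∀ i ∈ t, a i ≤ b i + c) :
    orderStat k (t.map a) ≤ orderStat k (t.map b) + c := by
  have hmem (f : ι → ℝ) : k ∈ Finset.Icc 1 (t.map f).card := by rwa [Multiset.card_map]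
  rw [orderStat_le_iff (hmem a)]
  refine ((orderStat_le_iff (hmem b) _).1 le_rfl).trans ?_
  rw [Multiset.countP_map, Multiset.countP_map]
  refine Multiset.card_le_card (Multiset.le_filter.2 ⟨Multiset.filter_le _ _, fun i hi => ?_⟩)
  have ⟨hit, hib⟩ := Multiset.mem_filter.1 hi
  exact (h i hit).trans (by linarith)

theorem orderStat_map_const_add (hk : k ∈ Finset.Icc 1 t.card) (a : ι → ℝ) (c : ℝ) :
    orderStat k (t.map fun i => c + a i) = c + orderStat k (t.map a) := by
  refine le_antisymm ?_ ?_
  · rw [add_comm c]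
    exact orderStat_map_le_add hk fun i _ => (add_comm c (a i)).le
  · rw [← le_sub_iff_add_le', sub_eq_add_neg]
    exact orderStat_map_le_add hk fun i _ => by simp

theorem orderStat_map_range_le_iff {e : ℕ} (hk : k ∈ Finset.Icc 1 e) (a : ℕ → ℝ) (x : ℝ) :
    orderStat k ((Multiset.range e).map a) ≤ x ↔ k ≤ ((Finset.range e).filter (a · ≤ x)).card := by
  rw [orderStat_le_iff (by simpa using hk), Multiset.countP_map]
  rfl

end OrderStat

section Measurability

variable {Ω : Type*} [MeasurableSpace Ω]

theorem measurable_card_filter_le {ι : Type*} (s : Finset ι) {Y : ι → Ω → ℝ}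
    (hY : ∀ i, Measurable (Y i)) (x : ℝ) : Measurable fun ω => (s.filter (Y · ω ≤ x)).card := by
  simp only [Finset.card_filter]
  exact Finset.measurable_sum _ fun i _ =>
    .ite (measurableSet_le (hY i) measurable_const) measurable_const measurable_const

theorem measurable_orderStat_map_range (k e : ℕ) {Y : ℕ → Ω → ℝ} (hY : ∀ i, Measurable (Y i)) :
    Measurable fun ω => orderStat k ((Multiset.range e).map (Y · ω)) := by
  wlog hk : 1 ≤ k generalizing k
  · obtain rfl : k = 0 := by omega
    -- `orderStat 0` and `orderStat 1` agree because `0 - 1 = 0`.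
    exact this 1 le_rfl
  obtain hke | hke := le_or_gt k e
  · refine measurable_of_Iic fun x => ?_
    simp only [Set.preimage, Set.mem_Iic, orderStat_map_range_le_iff (Finset.mem_Icc.2 ⟨hk, hke⟩)]
    exact measurableSet_le measurable_const (measurable_card_filter_le _ hY x)
  · have hzero (ω : Ω) : orderStat k ((Multiset.range e).map (Y · ω)) = 0 :=
      orderStat_eq_zero (by simp only [Multiset.card_map, Multiset.card_range]; omega)
    simp only [hzero, measurable_const]

theorem measurable_orderStat {d L : Ω → ℕ} (hd : Measurable d) (hL : Measurable L)
    {Y : ℕ → Ω → ℝ} (hY : ∀ i, Measurable (Y i)) :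
    Measurable fun ω => orderStat (L ω) ((Multiset.range (d ω)).map (Y · ω)) := by
  have h : Measurable fun p : (ℕ × ℕ) × Ω =>
      orderStat p.1.2 ((Multiset.range p.1.1).map (Y · p.2)) :=
    measurable_from_prod_countable_right fun p => measurable_orderStat_map_range p.2 p.1 hY
  exact h.comp ((hd.prodMk hL).prodMk measurable_id)

variable {d L : List ℕ → Ω → ℕ} {X : List ℕ → Ω → ℝ}

theorem measurable_brwPosition (hX : ∀ v, Measurable (X v)) (v : List ℕ) :
    Measurable (brwPosition X v) := by
  induction v with
  | nil => exact measurable_const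
  | cons i v ih => exact ih.add (hX (i :: v))

theorem measurable_voteValue (hd : ∀ v, Measurable (d v)) (hL : ∀ v, Measurable (L v))
    (hX : ∀ v, Measurable (X v)) (h : ℕ) (v : List ℕ) : Measurable (voteValue d L X h v) := by
  induction h generalizing v with
  | zero => exact measurable_brwPosition hX v
  | succ h ih => exact measurable_orderStat (hd v) (hL v) fun i => ih (i :: v)

theorem measurable_voteOutcome (hd : ∀ v, Measurable (d v)) (hL : ∀ v, Measurable (L v))
    (hX : ∀ v, Measurable (X v)) (n : ℕ) : Measurable (voteOutcome d L X n) :=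
  measurable_voteValue hd hL hX n []

end Measurability

/-! ### Votes on subtrees -/

section Pathwise

/-- The field `Y` seen from the vertex `v`: its values at the descendants of `v`, relabelled so
that `v` becomes the root. -/
def subtree {β : Type*} (v : List ℕ) (Y : List ℕ → β) (w : List ℕ) : β :=
  Y (w ++ v)

variable {Ω Ω' : Type*} {d L : List ℕ → Ω → ℕ} {X : List ℕ → Ω → ℝ} {ω : Ω}

theorem brwPosition_comp (f : Ω' → Ω) (v : List ℕ) (ω : Ω') :
    brwPosition (fun v => X v ∘ f) v ω = brwPosition X v (f ω) := by
  induction v with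
  | nil => rfl
  | cons i v ih => simp only [brwPosition, ih, Function.comp_apply]

theorem voteValue_comp (f : Ω' → Ω) (h : ℕ) (v : List ℕ) (ω : Ω') :
    voteValue (fun v => d v ∘ f) (fun v => L v ∘ f) (fun v => X v ∘ f) h v ω
      = voteValue d L X h v (f ω) := by
  induction h generalizing v with
  | zero => exact brwPosition_comp f v ω
  | succ h ih => simp only [voteValue, ih, Function.comp_apply]

/-- The outcome of the vote as a function of the family of all the marks `((d(v), L_v), X_v)`. -/
noncomputable def markOutcome (n : ℕ) : (List ℕ → (ℕ × ℕ) × ℝ) → ℝ :=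
  voteOutcome (fun v z => (z v).1.1) (fun v z => (z v).1.2) (fun v z => (z v).2) n

theorem measurable_markOutcome (n : ℕ) : Measurable (markOutcome n) :=
  measurable_voteOutcome (fun _ => by fun_prop) (fun _ => by fun_prop) (fun _ => by fun_prop) n

theorem markOutcome_comp (n : ℕ) :
    markOutcome n ∘ (fun ω v => ((d v ω, L v ω), X v ω)) = voteOutcome d L X n :=
  funext fun ω => (voteValue_comp (fun ω v => ((d v ω, L v ω), X v ω)) n [] ω).symm

theorem brwPosition_append (u v : List ℕ) :
    brwPosition X (u ++ v) ω = brwPosition X v ω + brwPosition (subtree v X) u ω := by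
  induction u with
  | nil => exact (add_zero _).symm
  | cons i u ih => rw [List.cons_append, brwPosition, ih, brwPosition, add_assoc]; rfl

theorem cons_notMem_erase_tails (i : ℕ) (v : List ℕ) : i :: v ∉ v.tails.toFinset.erase [] :=
  fun h => by
    have := ((List.mem_tails _ _).1 (List.mem_toFinset.1 (Finset.mem_of_mem_erase h))).length_le
    simp only [List.length_cons, Nat.not_succ_le_self] at this

theorem brwPosition_eq_sum (v : List ℕ) :
    brwPosition X v = ∑ w ∈ v.tails.toFinset.erase [], X w := by
  induction v with
  | nil => rfl
  | cons i v ih =>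
    rw [List.tails_cons, List.toFinset_cons, Finset.erase_insert_of_ne (List.cons_ne_nil i v),
      Finset.sum_insert (cons_notMem_erase_tails i v), ← ih, add_comm]
    rfl

theorem exists_brwPosition_eq_voteValue (hL : ∀ v, L v ω ∈ Finset.Icc 1 (d v ω)) (h : ℕ)
    (v : List ℕ) :
    ∃ u : List ℕ, u.length = h ∧ brwPosition X (u ++ v) ω = voteValue d L X h v ω := by
  induction h generalizing v with
  | zero => exact ⟨[], rfl, rfl⟩
  | succ h ih =>
    have hmem := orderStat_mem (s := (Multiset.range (d v ω)).map fun i =>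
      voteValue d L X h (i :: v) ω) (by simpa using hL v)
    obtain ⟨i, -, hi⟩ := Multiset.mem_map.1 hmem
    obtain ⟨u, hu, huv⟩ := ih (i :: v)
    exact ⟨u ++ [i], by simp [hu], by rw [voteValue, ← hi, ← huv, List.append_assoc]; rfl⟩

theorem voteValue_append (hL : ∀ v, L v ω ∈ Finset.Icc 1 (d v ω)) (h : ℕ) (u v : List ℕ) :
    voteValue d L X h (u ++ v) ω = brwPosition X v ω +
      voteValue (subtree v d) (subtree v L) (subtree v X) h u ω := by
  induction h generalizing u with
  | zero => exact brwPosition_append u v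
  | succ h ih =>
    simp only [voteValue, ← List.cons_append, ih]
    exact orderStat_map_const_add (by simpa using hL (u ++ v)) _ _

/-- The outcome of the vote in the subtree at the child `i` of the root, relative to the position
of this child. -/
noncomputable def childOutcome (d L : List ℕ → Ω → ℕ) (X : List ℕ → Ω → ℝ) (n i : ℕ) : Ω → ℝ :=
  voteOutcome (subtree [i] d) (subtree [i] L) (subtree [i] X) n

theorem voteOutcome_succ_le_iff (hL : ∀ v, L v ω ∈ Finset.Icc 1 (d v ω)) (n : ℕ) (x : ℝ) :
    voteOutcome d L X (n + 1) ω ≤ x ↔ L [] ω ≤ ((Finset.range (d [] ω)).filter fun i =>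
      X [i] ω + childOutcome d L X n i ω ≤ x).card := by
  rw [voteOutcome, voteValue, orderStat_map_range_le_iff (hL [])]
  have hchild (i : ℕ) : voteValue d L X n [i] ω = X [i] ω + childOutcome d L X n i ω := by
    rw [← List.nil_append [i], voteValue_append hL, List.nil_append, brwPosition, brwPosition,
      zero_add, childOutcome, voteOutcome]
  simp only [hchild]

variable {R : ℝ}

theorem abs_voteValue_succ_sub_le (hL : ∀ v, L v ω ∈ Finset.Icc 1 (d v ω))
    (hX : ∀ v, |X v ω| ≤ R) (h : ℕ) (v : List ℕ) :
    |voteValue d L X (h + 1) v ω - voteValue d L X h v ω| ≤ R := by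
  induction h generalizing v with
  | zero =>
    obtain ⟨u, hu, huv⟩ := exists_brwPosition_eq_voteValue (X := X) hL 1 v
    obtain ⟨i, rfl⟩ := List.length_eq_one_iff.1 hu
    rw [zero_add, ← huv]
    simpa [voteValue, brwPosition] using hX (i :: v)
  | succ h ih =>
    have hcard : L v ω ∈ Finset.Icc 1 (Multiset.range (d v ω)).card := by
      simpa only [Multiset.card_range] using hL v
    have hchild (i : ℕ) := abs_sub_le_iff.1 (ih (i :: v))
    rw [abs_sub_le_iff]
    constructor <;> refine sub_le_iff_le_add'.2 (orderStat_map_le_add hcard fun i _ => ?_)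
    · exact sub_le_iff_le_add'.1 (hchild i).1
    · exact sub_le_iff_le_add'.1 (hchild i).2

end Pathwise

/-! ### Independence and the binomial law -/

section Independence

variable {Ω ι : Type*} [MeasurableSpace Ω] {P : Measure Ω}

theorem indepFun_restrict_of_disjoint {β : ι → Type*} [∀ i, MeasurableSpace (β i)]
    {Z : ∀ i, Ω → β i} (hZ : ∀ i, Measurable (Z i)) (h : iIndepFun Z P) {S T : Set ι}
    (hST : Disjoint S T) :
    IndepFun (fun ω (i : S) => Z i ω) (fun ω (i : T) => Z i ω) P := by
  have hle (S : Set ι) : MeasurableSpace.comap (fun ω (i : S) => Z i ω) inferInstance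
      ≤ ⨆ i ∈ S, MeasurableSpace.comap (Z i) inferInstance := by
    refine @measurable_pi_lambda _ _ _ (_) _ _ (fun i => ?_) |>.comap_le
    exact measurable_iff_comap_le.2
      (le_iSup₂_of_le (f := fun i (_ : i ∈ S) => MeasurableSpace.comap (Z i) _) i.1 i.2 le_rfl)
  exact indep_of_indep_of_le (indep_iSup_of_disjoint (fun i => (hZ i).comap_le) h.iIndep hST)
    (hle S) (hle T)

theorem iIndepFun_curry {κ : ι → Type*} {β : ∀ i, κ i → Type*} {_ : ∀ i j, MeasurableSpace (β i j)}
    {Z : ∀ i j, Ω → β i j} (hZ : ∀ i j, Measurable (Z i j))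
    (h : iIndepFun (fun (p : (i : ι) × κ i) ω => Z p.1 p.2 ω) P) :
    iIndepFun (fun i ω j => Z i j ω) P := by
  have := h.isProbabilityMeasure
  have (i : ι) (j : κ i) : IsProbabilityMeasure (P.map (Z i j)) :=
    Measure.isProbabilityMeasure_map (hZ i j).aemeasurable
  have hrow (i : ι) : iIndepFun (Z i) P :=
    h.precomp (g := Sigma.mk i) sigma_mk_injective
  have hcurry : (fun ω i j => Z i j ω)
      = MeasurableEquiv.piCurry β ∘ fun ω (p : (i : ι) × κ i) => Z p.1 p.2 ω := rfl
  rw [iIndepFun_iff_map_fun_eq_infinitePi_map (by fun_prop), hcurry,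
    ← Measure.map_map (by fun_prop) (by fun_prop), h.map_fun_eq_infinitePi_map (by fun_prop),
    Measure.infinitePi_map_piCurry (fun i j => P.map (Z i j))]
  congrm Measure.infinitePi fun i => ?_
  exact ((hrow i).map_fun_eq_infinitePi_map (hZ i)).symm

theorem nullSingletonClass_map_add {G : Type*} [AddGroup G] [MeasurableSpace G]
    [MeasurableSingletonClass G] [MeasurableAdd₂ G] [IsFiniteMeasure P] {Y Z : Ω → G}
    (hY : Measurable Y) (hZ : Measurable Z) (h : IndepFun Y Z P) [NullSingletonClass (P.map Z)] :
    NullSingletonClass (P.map (Y + Z)) := by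
  refine ⟨fun x => ?_⟩
  have hset : MeasurableSet ((fun p : G × G => p.1 + p.2) ⁻¹' {x}) :=
    measurable_add (measurableSet_singleton x)
  have hsection (a : G) : Prod.mk a ⁻¹' ((fun p : G × G => p.1 + p.2) ⁻¹' {x}) = {-a + x} := by
    ext b
    simp [eq_neg_add_iff_add_eq]
  have hsum : Y + Z = (fun p : G × G => p.1 + p.2) ∘ fun ω => (Y ω, Z ω) := rfl
  rw [hsum, ← Measure.map_map measurable_add (hY.prodMk hZ),
    Measure.map_apply measurable_add (measurableSet_singleton x),
    (indepFun_iff_map_prod_eq_prod_map_map hY.aemeasurable hZ.aemeasurable).1 h,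
    Measure.measure_prod_null hset]
  exact .of_forall fun a => by simp only [hsection, measure_singleton, Pi.zero_apply]

theorem iIndepSet_preimage {β : ι → Type*} [∀ i, MeasurableSpace (β i)] {Z : ∀ i, Ω → β i}
    (hZ : ∀ i, Measurable (Z i)) (h : iIndepFun Z P) {B : ∀ i, Set (β i)}
    (hB : ∀ i, MeasurableSet (B i)) : iIndepSet (fun i => Z i ⁻¹' B i) P :=
  (iIndepSet_iff_meas_biInter fun i => hZ i (hB i)).2 fun _ =>
    h.meas_biInter fun i _ => ⟨B i, hB i, rfl⟩

end Independence

section Binomial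

open scoped unitInterval

variable {Ω ι : Type*} [MeasurableSpace Ω] {P : Measure Ω} {A : ι → Set Ω} {p : I}

theorem map_and_mem_eq_bernoulli [IsProbabilityMeasure P] {B : Set Ω} (hB : MeasurableSet B)
    (hp : P.real B = p) (a : Prop) :
    P.map (fun ω => a ∧ ω ∈ B) = unitInterval.toNNReal p • Measure.dirac a +
      unitInterval.toNNReal (unitInterval.symm p) • Measure.dirac False := by
  by_cases ha : a
  · have hPB : P B = unitInterval.toNNReal p := by
      rw [← ENNReal.ofReal_coe_nnreal, unitInterval.coe_toNNReal, ← hp, ofReal_measureReal]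
    have hPBc : P {ω | ω ∉ B} = unitInterval.toNNReal (unitInterval.symm p) := by
      change P Bᶜ = _
      rw [← ENNReal.ofReal_coe_nnreal, unitInterval.coe_toNNReal, unitInterval.coe_symm_eq, ← hp,
        ← probReal_compl_eq_one_sub hB, ofReal_measureReal]
    refine Measure.ext_of_singleton fun b => ?_
    rw [Measure.map_apply (by simpa [ha] using hB) (measurableSet_singleton b)]
    by_cases hb : b
    · simpa [ha, hb, Set.preimage] using hPB
    · simpa [ha, hb, Set.preimage] using hPBc
  · simp only [ha, false_and, Measure.map_const, measure_univ, one_smul, ← add_smul,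
      unitInterval.toNNReal_add_toNNReal_symm]

theorem isSetBernoulli_of_iIndepSet (hA : ∀ i, MeasurableSet (A i)) (h : iIndepSet A P)
    (hp : ∀ i, P.real (A i) = p) (u : Set ι) :
    IsSetBernoulli (fun ω => {i | i ∈ u ∧ ω ∈ A i}) u p P := by
  have := h.isProbabilityMeasure
  have hmeas (i : ι) : Measurable fun ω => i ∈ u ∧ ω ∈ A i :=
    measurable_const.and (measurable_mem.2 (hA i))
  have hindep : iIndepFun (fun i ω => i ∈ u ∧ ω ∈ A i) P :=
    iIndepFun.comp (f := fun i ω => ω ∈ A i) h.iIndep_comap_mem (fun i a => i ∈ u ∧ a)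
      fun i => .of_discrete
  have hmap := hindep.map_fun_eq_infinitePi_map hmeas
  simp only [map_and_mem_eq_bernoulli (hA _) (hp _)] at hmap
  refine ⟨(measurable_set_iff.2 hmeas).aemeasurable, ?_⟩
  rw [setBernoulli_eq_map, ← hmap, Measure.map_map (by fun_prop) (by fun_prop)]
  rfl

theorem hasLaw_card_filter_binomial {A : ℕ → Set Ω} [∀ i ω, Decidable (ω ∈ A i)]
    (hA : ∀ i, MeasurableSet (A i)) (h : iIndepSet A P) (hp : ∀ i, P.real (A i) = p) (e : ℕ) :
    HasLaw (fun ω => ((Finset.range e).filter (ω ∈ A ·)).card) (binomial e p) P := by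
  have hcount (ω : Ω) : ((Finset.range e).filter (ω ∈ A ·)).card
      = Set.ncard {i | i ∈ Set.Iio e ∧ ω ∈ A i} := by
    rw [← Set.ncard_coe_finset]
    simp
  simp only [hcount]
  exact HasLaw.fun_comp ⟨by fun_prop, rfl⟩ (isSetBernoulli_of_iIndepSet hA h hp (Set.Iio e))

theorem binomial_real_Ici (e k : ℕ) (p : I) : (binomial e p).real (Set.Ici k)
      = ∑ l ∈ Finset.Icc k e, (e.choose l : ℝ) * p ^ l * (1 - p) ^ (e - l) := by
  have hle : ∀ᵐ l ∂binomial e p, l ≤ e := ae_le_of_hasLaw_binomial (HasLaw.id (μ := binomial e p))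
  have hIci : Set.Ici k =ᵐ[binomial e p] (Finset.Icc k e : Set ℕ) := by
    filter_upwards [hle] with l hl
    change (l ∈ Set.Ici k) = (l ∈ (Finset.Icc k e : Set ℕ))
    simp [hl]
  rw [measureReal_congr hIci, ← sum_measureReal_singleton]
  exact Finset.sum_congr rfl fun l _ => binomial_real_singleton e l p

theorem measureReal_le_card_filter {A : ℕ → Set Ω} [∀ i ω, Decidable (ω ∈ A i)]
    (hA : ∀ i, MeasurableSet (A i)) (h : iIndepSet A P) (hp : ∀ i, P.real (A i) = p) (k e : ℕ) :
    P.real {ω | k ≤ ((Finset.range e).filter (ω ∈ A ·)).card}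
      = ∑ l ∈ Finset.Icc k e, (e.choose l : ℝ) * p ^ l * (1 - p) ^ (e - l) := by
  have hlaw := hasLaw_card_filter_binomial hA h hp e
  rw [← binomial_real_Ici, ← hlaw.map_eq, measureReal_def, measureReal_def,
    Measure.map_apply_of_aemeasurable hlaw.aemeasurable measurableSet_Ici]
  rfl

end Binomial

/-! ### The voting model -/

namespace ThresholdModel

variable (V : ThresholdModel)

theorem continuous_recursionPoly : Continuous V.recursionPoly := by
  unfold recursionPoly
  fun_prop

/-- The types of a particle: the pairs `(d, k)` of an offspring number and a threshold with
`1 ≤ k ≤ d ≤ d₀`. -/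
def types : Finset (ℕ × ℕ) :=
  ((Finset.Icc 1 V.d₀).sigma fun e => Finset.Icc 1 e).map (Equiv.sigmaEquivProd ℕ ℕ).toEmbedding

theorem mem_types {x : ℕ × ℕ} :
    x ∈ V.types ↔ x.1 ∈ Finset.Icc 1 V.d₀ ∧ x.2 ∈ Finset.Icc 1 x.1 := by
  simp [types, Equiv.sigmaEquivProd]

theorem sum_types (φ : ℕ × ℕ → ℝ) :
    ∑ x ∈ V.types, φ x = ∑ e ∈ Finset.Icc 1 V.d₀, ∑ k ∈ Finset.Icc 1 e, φ (e, k) := by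
  rw [types, Finset.sum_map, Finset.sum_sigma]
  rfl

theorem typeWeight_nonneg {x : ℕ × ℕ} (hx : x ∈ V.types) : 0 ≤ V.p x.1 * V.ζ x.2 x.1 := by
  rw [mem_types] at hx
  exact mul_nonneg (V.p_nonneg _ hx.1) (V.ζ_nonneg _ hx.1 _ hx.2)

theorem sum_typeWeight : ∑ x ∈ V.types, V.p x.1 * V.ζ x.2 x.1 = 1 := by
  rw [V.sum_types fun x => V.p x.1 * V.ζ x.2 x.1, ← V.p_sum]
  refine Finset.sum_congr rfl fun e he => ?_
  simp only [← Finset.mul_sum, V.ζ_sum e he, mul_one]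

/-- The law of the pair `(d(v), L_v)` at a particle `v`. -/
noncomputable def typeLaw : Measure (ℕ × ℕ) :=
  ∑ x ∈ V.types, ENNReal.ofReal (V.p x.1 * V.ζ x.2 x.1) • Measure.dirac x

theorem lintegral_typeLaw (φ : ℕ × ℕ → ENNReal) :
    ∫⁻ x, φ x ∂V.typeLaw = ∑ x ∈ V.types, ENNReal.ofReal (V.p x.1 * V.ζ x.2 x.1) * φ x := by
  simp only [typeLaw, lintegral_finsetSum_measure, lintegral_smul_measure, lintegral_dirac,
    smul_eq_mul]

theorem ae_typeLaw_mem_types : ∀ᵐ x ∂V.typeLaw, x ∈ V.types := by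
  simp only [typeLaw, ae_iff, Measure.coe_finsetSum, Finset.sum_apply, Measure.smul_apply]
  refine Finset.sum_eq_zero fun x hx => ?_
  simp [hx]

instance : IsProbabilityMeasure V.typeLaw := by
  refine ⟨?_⟩
  rw [← lintegral_one, lintegral_typeLaw]
  simp only [mul_one]
  rw [← ENNReal.ofReal_sum_of_nonneg fun x hx => V.typeWeight_nonneg hx, V.sum_typeWeight,
    ENNReal.ofReal_one]

end ThresholdModel

theorem eq_of_forall_le_singleton {α : Type*} [MeasurableSpace α] [Countable α]
    [MeasurableSingletonClass α] {μ ν : Measure α} [IsProbabilityMeasure μ]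
    [IsProbabilityMeasure ν] (h : ∀ x, μ {x} ≤ ν {x}) : μ = ν := by
  refine Measure.eq_of_le_of_isProbabilityMeasure (Measure.le_iff.2 fun s hs => ?_)
  rw [← μ.tsum_indicator_apply_singleton s hs, ← ν.tsum_indicator_apply_singleton s hs]
  exact ENNReal.tsum_le_tsum fun x => Set.indicator_le_indicator (h x)

namespace IsThresholdVoting

variable {Ω Ω' : Type*} [MeasurableSpace Ω] [MeasurableSpace Ω'] {P : Measure Ω} {P' : Measure Ω'}
  {V : ThresholdModel} {q : ℝ → ℝ} {d L : List ℕ → Ω → ℕ} {X : List ℕ → Ω → ℝ}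
  {d' L' : List ℕ → Ω' → ℕ} {X' : List ℕ → Ω' → ℝ}

theorem measurable_type (hM : IsThresholdVoting P V q d L X) (v : List ℕ) :
    Measurable fun ω => (d v ω, L v ω) :=
  (hM.measurable_d v).prodMk (hM.measurable_L v)

theorem measurable_mark (hM : IsThresholdVoting P V q d L X) (v : List ℕ) :
    Measurable fun ω => ((d v ω, L v ω), X v ω) :=
  (hM.measurable_type v).prodMk (hM.measurable_X v)

theorem measurable_outcome (hM : IsThresholdVoting P V q d L X) (n : ℕ) :
    Measurable (voteOutcome d L X n) :=
  measurable_voteOutcome hM.measurable_d hM.measurable_L hM.measurable_X n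

theorem isProbabilityMeasure (hM : IsThresholdVoting P V q d L X) : IsProbabilityMeasure P :=
  hM.indep_vertices.isProbabilityMeasure

theorem isProbabilityMeasure_map_outcome (hM : IsThresholdVoting P V q d L X) (n : ℕ) :
    IsProbabilityMeasure (P.map (voteOutcome d L X n)) :=
  have := hM.isProbabilityMeasure
  Measure.isProbabilityMeasure_map (hM.measurable_outcome n).aemeasurable

theorem map_type (hM : IsThresholdVoting P V q d L X) (v : List ℕ) :
    P.map (fun ω => (d v ω, L v ω)) = V.typeLaw := by
  have := hM.isProbabilityMeasure
  have := Measure.isProbabilityMeasure_map (μ := P) (hM.measurable_type v).aemeasurable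
  refine (eq_of_forall_le_singleton fun x => ?_).symm
  rw [← lintegral_indicator_one (measurableSet_singleton x), V.lintegral_typeLaw]
  by_cases hx : x ∈ V.types
  · obtain ⟨hd, hk⟩ := V.mem_types.1 hx
    rw [Measure.map_apply (hM.measurable_type v) (measurableSet_singleton x),
      Finset.sum_eq_single_of_mem x hx fun y _ hy => by simp [hy]]
    simpa [Set.preimage, Prod.ext_iff] using (hM.law_threshold v _ hd _ hk).ge
  · refine (Finset.sum_eq_zero fun y hy => ?_).trans_le zero_le
    simp [ne_of_mem_of_not_mem hy hx]

theorem map_mark (hM : IsThresholdVoting P V q d L X) (v : List ℕ) :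
    P.map (fun ω => ((d v ω, L v ω), X v ω))
      = V.typeLaw.prod (volume.withDensity fun x => ENNReal.ofReal (q x)) := by
  have := hM.isProbabilityMeasure
  rw [(indepFun_iff_map_prod_eq_prod_map_map (hM.measurable_type v).aemeasurable
    (hM.measurable_X v).aemeasurable).1 (hM.indep_displacement v), hM.map_type,
    hM.law_displacement]

theorem map_outcome_eq (hM : IsThresholdVoting P V q d L X)
    (hM' : IsThresholdVoting P' V q d' L' X') (n : ℕ) :
    P.map (voteOutcome d L X n) = P'.map (voteOutcome d' L' X' n) := by
  have hmarks : P.map (fun ω v => ((d v ω, L v ω), X v ω))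
      = P'.map fun ω v => ((d' v ω, L' v ω), X' v ω) := by
    rw [hM.indep_vertices.map_fun_eq_infinitePi_map hM.measurable_mark,
      hM'.indep_vertices.map_fun_eq_infinitePi_map hM'.measurable_mark]
    simp only [map_mark hM, map_mark hM']
  rw [← markOutcome_comp, ← markOutcome_comp,
    ← Measure.map_map (measurable_markOutcome n) (measurable_pi_iff.2 hM.measurable_mark), hmarks,
    Measure.map_map (measurable_markOutcome n) (measurable_pi_iff.2 hM'.measurable_mark)]

protected theorem subtree (hM : IsThresholdVoting P V q d L X) (v : List ℕ) :
    IsThresholdVoting P V q (subtree v d) (subtree v L) (subtree v X) where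
  measurable_d w := hM.measurable_d (w ++ v)
  measurable_L w := hM.measurable_L (w ++ v)
  measurable_X w := hM.measurable_X (w ++ v)
  indep_vertices := hM.indep_vertices.precomp (List.append_left_injective v)
  indep_displacement w := hM.indep_displacement (w ++ v)
  law_threshold w := hM.law_threshold (w ++ v)
  law_displacement w := hM.law_displacement (w ++ v)

theorem ae_threshold_mem_Icc (hM : IsThresholdVoting P V q d L X) :
    ∀ᵐ ω ∂P, ∀ v, L v ω ∈ Finset.Icc 1 (d v ω) := by
  refine ae_all_iff.2 fun v => ?_
  have hae := V.ae_typeLaw_mem_types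
  rw [← hM.map_type v] at hae
  filter_upwards [ae_of_ae_map (hM.measurable_type v).aemeasurable hae] with ω hω
  exact (V.mem_types.1 hω).2

theorem exists_ae_abs_displacement_le (hM : IsThresholdVoting P V q d L X)
    (hq : HasCompactSupport q) : ∃ R, 0 ≤ R ∧ ∀ᵐ ω ∂P, ∀ v, |X v ω| ≤ R := by
  obtain ⟨R, hR0, hR⟩ := hq.isCompact.isBounded.subset_closedBall_lt 0 0
  refine ⟨R, hR0.le, ae_all_iff.2 fun v => ?_⟩
  have hnull : P.map (X v) (tsupport q)ᶜ = 0 := by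
    have hopen := (isClosed_tsupport q).isOpen_compl.measurableSet
    rw [hM.law_displacement, withDensity_apply _ hopen,
      setLIntegral_congr_fun (g := 0) hopen fun x hx => by
        simp [image_eq_zero_of_notMem_tsupport hx]]
    exact lintegral_zero
  have hae : ∀ᵐ x ∂P.map (X v), x ∈ tsupport q := hnull
  filter_upwards [ae_of_ae_map (hM.measurable_X v).aemeasurable hae] with ω hω
  simpa using hR hω

theorem measureReal_threshold_le_card (hM : IsThresholdVoting P V q d L X) {Y : ℕ → Ω → ℝ}
    (hY : ∀ i, Measurable (Y i)) (hindep : iIndepFun Y P)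
    (hroot : IndepFun (fun ω => (d [] ω, L [] ω)) (fun ω i => Y i ω) P) {x : ℝ} {p : unitInterval}
    (hp : ∀ i, P.real {ω | Y i ω ≤ x} = p) :
    P.real {ω | L [] ω ≤ ((Finset.range (d [] ω)).filter (Y · ω ≤ x)).card}
      = V.recursionPoly p := by
  have := hM.isProbabilityMeasure
  have hYm : Measurable fun ω i => Y i ω := measurable_pi_iff.2 hY
  set A : Set ((ℕ × ℕ) × (ℕ → ℝ)) :=
    {z | z.1.2 ≤ ((Finset.range z.1.1).filter (z.2 · ≤ x)).card}
  have hAm : MeasurableSet A := measurableSet_le (by fun_prop) <|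
    measurable_from_prod_countable_right fun z =>
      measurable_card_filter_le (Finset.range z.1) (fun i => measurable_pi_apply i) x
  have hslice (z : ℕ × ℕ) : P.map (fun ω i => Y i ω) (Prod.mk z ⁻¹' A) = ENNReal.ofReal
      (∑ l ∈ Finset.Icc z.2 z.1, (z.1.choose l : ℝ) * p ^ l * (1 - p) ^ (z.1 - l)) := by
    rw [Measure.map_apply hYm (measurable_prodMk_left hAm),
      ← measureReal_le_card_filter (fun i => measurableSet_le (hY i) measurable_const)
        (iIndepSet_preimage hY hindep fun _ => measurableSet_Iic) hp, ofReal_measureReal]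
    rfl
  have hprod : P {ω | L [] ω ≤ ((Finset.range (d [] ω)).filter (Y · ω ≤ x)).card}
      = (P.map (fun ω => (d [] ω, L [] ω))).prod (P.map fun ω i => Y i ω) A := by
    rw [← (indepFun_iff_map_prod_eq_prod_map_map (hM.measurable_type []).aemeasurable
      hYm.aemeasurable).1 hroot, Measure.map_apply ((hM.measurable_type []).prodMk hYm) hAm]
    rfl
  rw [measureReal_def, hprod, Measure.prod_apply hAm, hM.map_type, V.lintegral_typeLaw]
  simp only [hslice]
  rw [ENNReal.toReal_sum (by simp [ENNReal.mul_ne_top]), ThresholdModel.recursionPoly,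
    ← V.sum_types fun z => V.p z.1 * V.ζ z.2 z.1 *
      ∑ l ∈ Finset.Icc z.2 z.1, (z.1.choose l : ℝ) * p ^ l * (1 - p) ^ (z.1 - l)]
  refine Finset.sum_congr rfl fun z hz => ?_
  rw [ENNReal.toReal_mul, ENNReal.toReal_ofReal (V.typeWeight_nonneg hz), ENNReal.toReal_ofReal]
  have := p.2.1
  have := unitInterval.one_minus_nonneg p
  positivity

variable {R : ℝ}

theorem measurable_childOutcome (hM : IsThresholdVoting P V q d L X) (n i : ℕ) :
    Measurable (childOutcome d L X n i) :=
  (hM.subtree [i]).measurable_outcome n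

theorem iIndepFun_childOutcome (hM : IsThresholdVoting P V q d L X) (n : ℕ) :
    iIndepFun (childOutcome d L X n) P := by
  have hinj : Function.Injective fun p : (_ : ℕ) × List ℕ => p.2 ++ [p.1] := by
    rintro ⟨i, v⟩ ⟨j, w⟩ h
    obtain ⟨rfl, hij⟩ := List.append_inj' h rfl
    obtain rfl := List.singleton_injective hij
    rfl
  have hmarks := iIndepFun_curry (fun i w => hM.measurable_mark (w ++ [i]))
    (hM.indep_vertices.precomp hinj)
  have hchild (i : ℕ) : childOutcome d L X n i = markOutcome n ∘
      fun ω w => ((d (w ++ [i]) ω, L (w ++ [i]) ω), X (w ++ [i]) ω) :=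
    (markOutcome_comp n).symm
  rw [funext hchild]
  exact hmarks.comp _ fun _ => measurable_markOutcome n

theorem indepFun_type_childOutcome (hM : IsThresholdVoting P V q d L X) (n : ℕ) :
    IndepFun (fun ω => (d [] ω, L [] ω)) (fun ω i => childOutcome d L X n i ω) P := by
  have hrestrict := indepFun_restrict_of_disjoint hM.measurable_mark hM.indep_vertices
    (S := {[]}) (T := {[]}ᶜ) disjoint_compl_right
  have hchild : (fun ω i => childOutcome d L X n i ω) =
      (fun z i => markOutcome n fun w => z ⟨w ++ [i], List.append_ne_nil_of_right_ne_nil w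
        (List.cons_ne_nil i [])⟩) ∘
      fun ω (v : ({[]}ᶜ : Set (List ℕ))) => ((d v ω, L v ω), X v ω) :=
    funext fun ω => funext fun i => congrFun (markOutcome_comp n).symm ω
  rw [hchild]
  refine hrestrict.comp (φ := fun z => (z ⟨[], rfl⟩).1) (by fun_prop) ?_
  exact measurable_pi_iff.2 fun i => (measurable_markOutcome n).comp (by fun_prop)

theorem cdf_outcome (hM : IsThresholdVoting P V q d L X) (n : ℕ) (x : ℝ) :
    cdf (P.map (voteOutcome d L X n)) x = P.real {ω | voteOutcome d L X n ω ≤ x} := by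
  have := hM.isProbabilityMeasure_map_outcome n
  rw [cdf_eq_real, map_measureReal_apply (hM.measurable_outcome n) measurableSet_Iic]
  rfl

theorem measureReal_threshold_le_card_childOutcome (hM : IsThresholdVoting P V q d L X) (n : ℕ)
    (x : ℝ) :
    P.real {ω | L [] ω ≤ ((Finset.range (d [] ω)).filter (childOutcome d L X n · ω ≤ x)).card}
      = V.recursionPoly (cdf (P.map (voteOutcome d L X n)) x) := by
  refine hM.measureReal_threshold_le_card (hM.measurable_childOutcome n)
    (hM.iIndepFun_childOutcome n) (hM.indepFun_type_childOutcome n)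
    (p := ⟨_, cdf_nonneg _ x, cdf_le_one _ x⟩) fun i => ?_
  have hcdf := (hM.subtree [i]).cdf_outcome n x
  rw [(hM.subtree [i]).map_outcome_eq hM n] at hcdf
  exact hcdf.symm

theorem recursionPoly_cdf_sub_le (hM : IsThresholdVoting P V q d L X)
    (hR : ∀ᵐ ω ∂P, ∀ v, |X v ω| ≤ R) (n : ℕ) (x : ℝ) :
    V.recursionPoly (cdf (P.map (voteOutcome d L X n)) (x - R))
      ≤ cdf (P.map (voteOutcome d L X (n + 1))) x := by
  have := hM.isProbabilityMeasure
  rw [← hM.measureReal_threshold_le_card_childOutcome, hM.cdf_outcome]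
  refine ENNReal.toReal_mono (measure_ne_top _ _) (measure_mono_ae ?_)
  filter_upwards [hM.ae_threshold_mem_Icc, hR] with ω hL hX hle
  refine (voteOutcome_succ_le_iff hL n x).2 (hle.trans ?_)
  refine Finset.card_le_card (Finset.monotone_filter_right _ fun i _ hi => ?_)
  linarith [(abs_le.1 (hX [i])).2]

theorem cdf_le_recursionPoly_cdf_add (hM : IsThresholdVoting P V q d L X)
    (hR : ∀ᵐ ω ∂P, ∀ v, |X v ω| ≤ R) (n : ℕ) (x : ℝ) :
    cdf (P.map (voteOutcome d L X (n + 1))) x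
      ≤ V.recursionPoly (cdf (P.map (voteOutcome d L X n)) (x + R)) := by
  have := hM.isProbabilityMeasure
  rw [← hM.measureReal_threshold_le_card_childOutcome, hM.cdf_outcome]
  refine ENNReal.toReal_mono (measure_ne_top _ _) (measure_mono_ae ?_)
  filter_upwards [hM.ae_threshold_mem_Icc, hR] with ω hL hX hle
  refine ((voteOutcome_succ_le_iff hL n x).1 hle).trans ?_
  refine Finset.card_le_card (Finset.monotone_filter_right _ fun i _ hi => ?_)
  linarith [(abs_le.1 (hX [i])).1]

theorem cdf_sub_le_cdf_succ (hM : IsThresholdVoting P V q d L X)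
    (hR : ∀ᵐ ω ∂P, ∀ v, |X v ω| ≤ R) (n : ℕ) (x : ℝ) :
    cdf (P.map (voteOutcome d L X n)) (x - R) ≤ cdf (P.map (voteOutcome d L X (n + 1))) x := by
  have := hM.isProbabilityMeasure
  rw [hM.cdf_outcome, hM.cdf_outcome]
  refine ENNReal.toReal_mono (measure_ne_top _ _) (measure_mono_ae ?_)
  filter_upwards [hM.ae_threshold_mem_Icc, hR] with ω hL hX (hle : voteValue d L X n [] ω ≤ x - R)
  change voteValue d L X (n + 1) [] ω ≤ x
  linarith [(abs_le.1 (abs_voteValue_succ_sub_le hL hX n [])).2]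

theorem cdf_succ_le_cdf_add (hM : IsThresholdVoting P V q d L X)
    (hR : ∀ᵐ ω ∂P, ∀ v, |X v ω| ≤ R) (n : ℕ) (x : ℝ) :
    cdf (P.map (voteOutcome d L X (n + 1))) x ≤ cdf (P.map (voteOutcome d L X n)) (x + R) := by
  have := hM.isProbabilityMeasure
  rw [hM.cdf_outcome, hM.cdf_outcome]
  refine ENNReal.toReal_mono (measure_ne_top _ _) (measure_mono_ae ?_)
  filter_upwards [hM.ae_threshold_mem_Icc, hR] with ω hL hX
    (hle : voteValue d L X (n + 1) [] ω ≤ x)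
  change voteValue d L X n [] ω ≤ x + R
  linarith [(abs_le.1 (abs_voteValue_succ_sub_le hL hX n [])).1]

theorem nullSingletonClass_map_brwPosition (hM : IsThresholdVoting P V q d L X) {v : List ℕ}
    (hv : v ≠ []) : NullSingletonClass (P.map (brwPosition X v)) := by
  have := hM.isProbabilityMeasure
  obtain ⟨i, v, rfl⟩ := List.exists_cons_of_ne_nil hv
  have hindep : iIndepFun X P :=
    hM.indep_vertices.comp (fun _ z => z.2) fun _ => measurable_snd
  have : NullSingletonClass (P.map (X (i :: v))) := by
    rw [hM.law_displacement]
    infer_instance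
  have h := hindep.indepFun_finsetSum_of_notMem hM.measurable_X (cons_notMem_erase_tails i v)
  rw [← brwPosition_eq_sum] at h
  exact nullSingletonClass_map_add (measurable_brwPosition hM.measurable_X v)
    (hM.measurable_X (i :: v)) h

theorem nullSingletonClass_map_outcome_succ (hM : IsThresholdVoting P V q d L X) (n : ℕ) :
    NullSingletonClass (P.map (voteOutcome d L X (n + 1))) := by
  refine ⟨fun x => ?_⟩
  have hnull : ∀ᵐ ω ∂P, ∀ v : List ℕ, v ≠ [] → brwPosition X v ω ≠ x := by
    refine ae_all_iff.2 fun v => ?_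
    by_cases hv : v = []
    · exact .of_forall fun _ h => absurd hv h
    have := hM.nullSingletonClass_map_brwPosition hv
    have hae := measure_eq_zero_iff_ae_notMem.1 (measure_singleton (μ := P.map (brwPosition X v)) x)
    filter_upwards [ae_of_ae_map (measurable_brwPosition hM.measurable_X v).aemeasurable hae]
      with ω hω _ using hω
  rw [Measure.map_apply (hM.measurable_outcome _) (measurableSet_singleton x),
    measure_eq_zero_iff_ae_notMem]
  filter_upwards [hM.ae_threshold_mem_Icc, hnull] with ω hL hω hx
  obtain ⟨u, hu, hux⟩ := exists_brwPosition_eq_voteValue (X := X) hL (n + 1) []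
  refine hω (u ++ []) ?_ (hux.trans hx)
  rw [List.append_nil]
  exact List.ne_nil_of_length_eq_add_one hu

end IsThresholdVoting

/-! ### Climbing between fixed points -/

section Climb

theorem exists_pos_forall_le_or_forall_le_neg {E : Type*} [TopologicalSpace E] {s : Set E}
    (hs : IsCompact s) (hs' : IsPreconnected s) {φ : E → ℝ} (hφ : ContinuousOn φ s)
    (hne : ∀ u ∈ s, φ u ≠ 0) : ∃ c > 0, (∀ u ∈ s, c ≤ φ u) ∨ ∀ u ∈ s, φ u ≤ -c := by
  obtain ⟨c, hc, hcφ⟩ := hs.exists_forall_le' hφ.abs fun u hu => abs_pos.2 (hne u hu)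
  refine ⟨c, hc, ?_⟩
  by_contra! h
  obtain ⟨⟨u, hu, huc⟩, v, hv, hvc⟩ := h
  have hu0 : φ u ≤ 0 := by
    rcases le_abs.1 (hcφ u hu) with h | h <;> linarith
  have hv0 : 0 ≤ φ v := by
    rcases le_abs.1 (hcφ v hv) with h | h <;> linarith
  obtain ⟨w, hw, hw0⟩ := hs'.intermediate_value hu hv hφ ⟨hu0, hv0⟩
  exact hne w hw hw0

variable {F g : ℝ → ℝ} {a b c r x : ℝ}

theorem min_add_mul_le_shift (hF : Monotone F) (hr : 0 ≤ r)
    (hg : ∀ u ∈ Set.Icc a b, u + c ≤ g u) (hgF : ∀ x, g (F x) ≤ F (x + r)) (hx : a ≤ F x) (k : ℕ) :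
    min b (a + k * c) ≤ F (x + k * r) := by
  induction k with
  | zero => simpa using Or.inr hx
  | succ k ih =>
    have hstep : x + (k + 1 : ℕ) * r = x + k * r + r := by push_cast; ring
    rw [hstep]
    have ha : a ≤ F (x + k * r) := hx.trans (hF (by nlinarith [k.cast_nonneg (α := ℝ)]))
    rcases le_or_gt b (F (x + k * r)) with hb | hb
    · exact (min_le_left _ _).trans (hb.trans (hF (by linarith)))
    · have hk : a + k * c ≤ F (x + k * r) := (min_le_iff.1 ih).resolve_left hb.not_ge
      refine (min_le_right _ _).trans ?_
      push_cast
      linarith [hg _ ⟨ha, hb.le⟩, hgF (x + k * r)]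

theorem shift_le_max_sub_mul (hF : Monotone F) (hr : 0 ≤ r)
    (hg : ∀ u ∈ Set.Icc a b, g u ≤ u - c) (hFg : ∀ x, F (x - r) ≤ g (F x)) (hx : F x ≤ b) (k : ℕ) :
    F (x - k * r) ≤ max a (b - k * c) := by
  have hreflect := min_add_mul_le_shift (F := fun y => -F (-y)) (g := fun u => -g (-u))
    (a := -b) (b := -a) (c := c) (x := -x)
    (fun y z hyz => neg_le_neg (hF (neg_le_neg hyz))) hr
    (fun u hu => by linarith [hg (-u) ⟨by linarith [hu.2], by linarith [hu.1]⟩])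
    (fun y => ?_) (by simpa using hx) k
  · rw [show -(-x + k * r) = x - k * r by ring, show -b + k * c = -(b - k * c) by ring,
      min_neg_neg] at hreflect
    exact neg_le_neg_iff.1 hreflect
  · rw [neg_neg, neg_add']
    exact neg_le_neg (hFg (-y))

theorem exists_climb (hg : ContinuousOn g (Set.Icc a b)) (hfix : ∀ u ∈ Set.Icc a b, g u - u ≠ 0)
    (hr : 0 ≤ r) :
    ∃ K, ∀ F : ℝ → ℝ, Monotone F → (∀ x, g (F x) ≤ F (x + r)) → (∀ x, F (x - r) ≤ g (F x)) →
      ∀ x, a < F x → b ≤ F (x + K) := by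
  obtain ⟨c, hc, hsign⟩ := exists_pos_forall_le_or_forall_le_neg isCompact_Icc
    isPreconnected_Icc (hg.sub continuousOn_id) hfix
  obtain ⟨k, hk⟩ := exists_nat_gt ((b - a) / c)
  rw [div_lt_iff₀ hc] at hk
  refine ⟨k * r, fun F hF hgF hFg x hx => ?_⟩
  obtain hup | hdown := hsign
  · have hclimb := min_add_mul_le_shift (b := b) hF hr
      (fun u hu => le_sub_iff_add_le'.1 (hup u hu)) hgF hx.le k
    rwa [min_eq_left (by linarith)] at hclimb
  · by_contra! hlt
    have hdescend := shift_le_max_sub_mul (a := a) (c := c) hF hr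
      (fun u hu => by have : g u - u ≤ -c := hdown u hu; linarith) hFg hlt.le k
    rw [max_eq_left (by linarith), add_sub_cancel_right] at hdescend
    exact hdescend.not_gt hx

end Climb

theorem IsThresholdVoting.exists_climb {Ω : Type*} [MeasurableSpace Ω] {P : Measure Ω}
    {V : ThresholdModel} {q : ℝ → ℝ} {d L : List ℕ → Ω → ℕ} {X : List ℕ → Ω → ℝ}
    (hM : IsThresholdVoting P V q d L X) (hq : HasCompactSupport q) {a b : ℝ}
    (hne : ∀ u ∈ Set.Icc a b, V.nonlinearity u ≠ 0) :
    ∃ K, ∀ n x, a < cdf (P.map (voteOutcome d L X n)) x →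
      b ≤ cdf (P.map (voteOutcome d L X n)) (x + K) := by
  obtain ⟨R, hR0, hR⟩ := hM.exists_ae_abs_displacement_le hq
  obtain ⟨K, hK⟩ := _root_.exists_climb V.continuous_recursionPoly.continuousOn hne
    (add_nonneg hR0 hR0)
  refine ⟨K, fun n => hK _ (monotone_cdf _) (fun x => ?_) fun x => ?_⟩
  · have hrec := hM.recursionPoly_cdf_sub_le hR n (x + R)
    have hshift := hM.cdf_succ_le_cdf_add hR n (x + R)
    rw [add_sub_cancel_right] at hrec
    rw [add_assoc] at hshift
    exact hrec.trans hshift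
  · have hrec := hM.cdf_le_recursionPoly_cdf_add hR n (x - R)
    have hshift := hM.cdf_sub_le_cdf_succ hR n (x - R)
    rw [sub_add_cancel] at hrec
    rw [sub_sub] at hshift
    exact hshift.trans hrec

/-! ### Conditioning between quantiles -/

theorem measurableSet_realIcc (a b : EReal) : MeasurableSet (realIcc a b) :=
  measurable_coe_real_ereal measurableSet_Icc

theorem measure_coe_lt_eq_measure_coe_le (μ : Measure ℝ) [NullSingletonClass μ] (a : EReal) :
    μ {y : ℝ | (y : EReal) < a} = μ {y : ℝ | (y : EReal) ≤ a} := by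
  have hsub : {y : ℝ | (y : EReal) = a}.Subsingleton := fun x hx y hy =>
    EReal.coe_injective (hx.trans hy.symm)
  refine measure_congr ?_
  filter_upwards [measure_eq_zero_iff_ae_notMem.1 (hsub.measure_zero μ)] with y hy
  exact propext (Ne.le_iff_lt hy).symm

namespace IsQuantile

variable {μ : Measure ℝ} {α β : ℝ} {a b : EReal}

theorem real_coe_lt_le [IsFiniteMeasure μ] (hα : 0 ≤ α) (ha : IsQuantile μ α a) :
    μ.real {y : ℝ | (y : EReal) < a} ≤ α :=
  ENNReal.toReal_le_of_le_ofReal hα ha.1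

theorem le_real_coe_le [IsFiniteMeasure μ] (ha : IsQuantile μ α a) :
    α ≤ μ.real {y : ℝ | (y : EReal) ≤ a} :=
  (ENNReal.ofReal_le_iff_le_toReal (measure_ne_top _ _)).1 ha.2

theorem sub_le_real_realIcc [IsFiniteMeasure μ] (hα : 0 ≤ α) (ha : IsQuantile μ α a)
    (hb : IsQuantile μ β b) : β - α ≤ μ.real (realIcc a b) := by
  have hcover : {y : ℝ | (y : EReal) ≤ b} ⊆ {y : ℝ | (y : EReal) < a} ∪ realIcc a b := by
    intro y hy
    exact (lt_or_ge (y : EReal) a).imp_right fun h => ⟨h, hy⟩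
  have hunion := (measureReal_mono (μ := μ) hcover).trans (measureReal_union_le _ _)
  linarith [ha.real_coe_lt_le hα, hb.le_real_coe_le]

theorem measure_realIcc_ne_zero [IsFiniteMeasure μ] (hα : 0 ≤ α) (hαβ : α < β)
    (ha : IsQuantile μ α a) (hb : IsQuantile μ β b) : μ (realIcc a b) ≠ 0 := fun h0 => by
  have hle := ha.sub_le_real_realIcc hα hb
  rw [measureReal_def, h0, ENNReal.toReal_zero] at hle
  linarith

theorem real_realIcc_inter_Iic_le [IsProbabilityMeasure μ] [NullSingletonClass μ]
    (ha : IsQuantile μ α a) (b : EReal) {t η : ℝ} (hη : 0 ≤ η) (ht : cdf μ t ≤ α + η) :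
    μ.real (realIcc a b ∩ Set.Iic t) ≤ η := by
  rw [cdf_eq_real] at ht
  rcases lt_or_ge (t : EReal) a with hta | hat
  · have hempty : realIcc a b ∩ Set.Iic t = ∅ :=
      Set.eq_empty_of_forall_notMem fun y hy =>
        hta.not_ge (hy.1.1.trans (EReal.coe_le_coe_iff.2 hy.2))
    rwa [hempty, measureReal_empty]
  · have hα : α ≤ μ.real {y : ℝ | (y : EReal) < a} := by
      rw [measureReal_def, measure_coe_lt_eq_measure_coe_le]
      exact ha.le_real_coe_le
    have hdisj : Disjoint (realIcc a b ∩ Set.Iic t) {y : ℝ | (y : EReal) < a} :=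
      Set.disjoint_left.2 fun y hy hya => hya.not_ge hy.1.1
    have hsub : realIcc a b ∩ Set.Iic t ∪ {y : ℝ | (y : EReal) < a} ⊆ Set.Iic t :=
      Set.union_subset Set.inter_subset_right fun y hy => EReal.coe_le_coe_iff.1 (hy.le.trans hat)
    have hsum := measureReal_mono (μ := μ) hsub
    rw [measureReal_union hdisj (measurable_coe_real_ereal measurableSet_Iio)] at hsum
    linarith

theorem real_realIcc_inter_Ioi_le [IsProbabilityMeasure μ] [NullSingletonClass μ] (hβ : 0 ≤ β)
    (a : EReal) (hb : IsQuantile μ β b) {t η : ℝ} (hη : 0 ≤ η) (ht : β - η ≤ cdf μ t) :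
    μ.real (realIcc a b ∩ Set.Ioi t) ≤ η := by
  rw [cdf_eq_real] at ht
  rcases lt_or_ge b (t : EReal) with hbt | htb
  · have hempty : realIcc a b ∩ Set.Ioi t = ∅ :=
      Set.eq_empty_of_forall_notMem fun y hy =>
        hbt.not_ge ((EReal.coe_le_coe_iff.2 hy.2.le).trans hy.1.2)
    rwa [hempty, measureReal_empty]
  · have hβ' : μ.real {y : ℝ | (y : EReal) ≤ b} ≤ β := by
      rw [measureReal_def, ← measure_coe_lt_eq_measure_coe_le]
      exact hb.real_coe_lt_le hβ
    have hdisj : Disjoint (Set.Iic t) (realIcc a b ∩ Set.Ioi t) :=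
      (Set.Iic_disjoint_Ioi le_rfl).mono_right Set.inter_subset_right
    have hsub : Set.Iic t ∪ realIcc a b ∩ Set.Ioi t ⊆ {y : ℝ | (y : EReal) ≤ b} :=
      Set.union_subset (fun y hy => (EReal.coe_le_coe_iff.2 hy).trans htb) fun y hy => hy.1.2
    have hsum := measureReal_mono (μ := μ) hsub
    rw [measureReal_union hdisj ((measurableSet_realIcc a b).inter measurableSet_Ioi)] at hsum
    linarith

theorem cond_realIcc_Iic_le_or_Ioi_le [IsProbabilityMeasure μ] [NullSingletonClass μ] (hα : 0 ≤ α)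
    (hαβ : α < β) (ha : IsQuantile μ α a) (hb : IsQuantile μ β b) {θ K : ℝ} (hθ : 0 ≤ θ)
    (hK : ∀ x, α + θ * (β - α) < cdf μ x → β - θ * (β - α) ≤ cdf μ (x + K)) (t : ℝ) :
    (μ[|realIcc a b]).real (Set.Iic t) ≤ θ ∨ (μ[|realIcc a b]).real (Set.Ioi (t + K)) ≤ θ := by
  have hη : 0 ≤ θ * (β - α) := mul_nonneg hθ (sub_nonneg.2 hαβ.le)
  have hcond : ∀ s, μ.real (realIcc a b ∩ s) ≤ θ * (β - α) → (μ[|realIcc a b]).real s ≤ θ := by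
    intro s hs
    have hI := ha.sub_le_real_realIcc hα hb
    rw [measureReal_def, cond_apply (measurableSet_realIcc a b), ENNReal.toReal_mul,
      ENNReal.toReal_inv]
    rw [← measureReal_def, ← measureReal_def, inv_mul_le_iff₀ (by linarith), mul_comm]
    exact hs.trans (mul_le_mul_of_nonneg_left hI hθ)
  refine (le_or_gt (cdf μ t) (α + θ * (β - α))).imp (fun h => hcond _ ?_) fun h => hcond _ ?_
  · exact ha.real_realIcc_inter_Iic_le b hη h
  · exact real_realIcc_inter_Ioi_le (hα.trans hαβ.le) a hb hη (hK t h)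

theorem le_real_Iic [IsFiniteMeasure μ] {m : ℝ} (hm : IsQuantile μ α m) :
    α ≤ μ.real (Set.Iic m) := by
  simpa only [EReal.coe_le_coe_iff, Set.Iic_def] using hm.le_real_coe_le

theorem one_sub_le_real_Ici [IsProbabilityMeasure μ] {m : ℝ} (hα : 0 ≤ α)
    (hm : IsQuantile μ α m) : 1 - α ≤ μ.real (Set.Ici m) := by
  have hlt : μ.real (Set.Iio m) ≤ α := by
    simpa only [EReal.coe_lt_coe_iff, Set.Iio_def] using hm.real_coe_lt_le hα
  rw [← Set.compl_Iio, probReal_compl_eq_one_sub measurableSet_Iio]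
  linarith

theorem real_compl_Icc_le [IsProbabilityMeasure μ] {m θ K K' : ℝ} (hm : IsQuantile μ (1 / 2) m)
    (hθ : θ < 1 / 2) (htail : ∀ t, μ.real (Set.Iic t) ≤ θ ∨ μ.real (Set.Ioi (t + K)) ≤ θ)
    (hK : K < K') : μ.real (Set.Icc (m - K') (m + K'))ᶜ ≤ 2 * θ := by
  have hright : μ.real (Set.Ioi (m + K')) ≤ θ := by
    refine (measureReal_mono (Set.Ioi_subset_Ioi (by linarith))).trans
      ((htail m).resolve_left fun h => ?_)
    linarith [hm.le_real_Iic]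
  have hleft : μ.real (Set.Iic (m - K')) ≤ θ := by
    refine (htail (m - K')).resolve_right fun h => ?_
    have hsub : Set.Ici m ⊆ Set.Ioi (m - K' + K) := Set.Ici_subset_Ioi.2 (by linarith)
    linarith [measureReal_mono (μ := μ) hsub, hm.one_sub_le_real_Ici (by norm_num)]
  calc μ.real (Set.Icc (m - K') (m + K'))ᶜ
      ≤ μ.real (Set.Iic (m - K') ∪ Set.Ioi (m + K')) := by
        rw [← Set.Ici_inter_Iic, Set.compl_inter, Set.compl_Ici, Set.compl_Iic]
        exact measureReal_mono (Set.union_subset_union_left _ Set.Iio_subset_Iic_self)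
    _ ≤ 2 * θ := by linarith [measureReal_union_le (μ := μ) (Set.Iic (m - K')) (Set.Ioi (m + K'))]

end IsQuantile

/-! ### Tightness -/

theorem isTightMeasureSet_range_of_succ {E : Type*} [MeasurableSpace E] [TopologicalSpace E]
    [TopologicalSpace.IsCompletelyPseudoMetrizableSpace E] [SecondCountableTopology E]
    [BorelSpace E] {μ : ℕ → Measure E} [IsFiniteMeasure (μ 0)]
    (h : IsTightMeasureSet (Set.range fun n => μ (n + 1))) : IsTightMeasureSet (Set.range μ) := by
  rw [← Nat.range_of_succ]
  exact isTightMeasureSet_singleton.union h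

theorem isTightMeasureSet_range_map_sub {ι : Type*} {μ : ι → Measure ℝ}
    [∀ i, IsFiniteMeasure (μ i)] {m : ι → ℝ}
    (h : ∀ ε > 0, ∃ K, ∀ i, (μ i).real (Set.Icc (m i - K) (m i + K))ᶜ ≤ ε) :
    IsTightMeasureSet (Set.range fun i => (μ i).map fun x => x - m i) := by
  rw [isTightMeasureSet_iff_exists_isCompact_measure_compl_le]
  intro ε hε
  rcases eq_or_ne ε ⊤ with rfl | hε'
  · exact ⟨∅, isCompact_empty, fun _ _ => le_top⟩
  obtain ⟨K, hK⟩ := h ε.toReal (ENNReal.toReal_pos hε.ne' hε')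
  refine ⟨Set.Icc (-K) K, isCompact_Icc, Set.forall_mem_range.2 fun i => ?_⟩
  rw [Measure.map_apply (by fun_prop) measurableSet_Icc.compl, Set.preimage_compl,
    Set.preimage_sub_const_Icc, neg_add_eq_sub, add_comm K]
  exact (ENNReal.toReal_le_toReal (measure_ne_top _ _) hε').1 (hK i)

theorem isTightMeasureSet_range_cond_realIcc_map_sub {ι : Type*} {μ : ι → Measure ℝ}
    [∀ i, IsProbabilityMeasure (μ i)] [∀ i, NullSingletonClass (μ i)] {α β : ℝ} (hα : 0 ≤ α)
    (hαβ : α < β)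
    (hclimb : ∀ η > 0, ∃ K, ∀ i x, α + η < cdf (μ i) x → β - η ≤ cdf (μ i) (x + K))
    {A B : ι → EReal} (hA : ∀ i, IsQuantile (μ i) α (A i)) (hB : ∀ i, IsQuantile (μ i) β (B i))
    {m : ι → ℝ} (hm : ∀ i, IsQuantile ((μ i)[|realIcc (A i) (B i)]) (1 / 2) (m i)) :
    IsTightMeasureSet
      (Set.range fun i => ((μ i)[|realIcc (A i) (B i)]).map fun x => x - m i) := by
  have (i : ι) : IsProbabilityMeasure ((μ i)[|realIcc (A i) (B i)]) :=
    cond_isProbabilityMeasure ((hA i).measure_realIcc_ne_zero hα hαβ (hB i))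
  refine isTightMeasureSet_range_map_sub fun ε hε => ?_
  have hθ : 0 < min (ε / 2) (1 / 3) := by positivity
  obtain ⟨K, hK⟩ := hclimb _ (mul_pos hθ (sub_pos.2 hαβ))
  refine ⟨K + 1, fun i => ?_⟩
  have htail := (hA i).cond_realIcc_Iic_le_or_Ioi_le hα hαβ (hB i) hθ.le (hK i)
  have hthird : min (ε / 2) (1 / 3) < 1 / 2 := (min_le_right _ _).trans_lt (by norm_num)
  have hbound := (hm i).real_compl_Icc_le hthird htail (lt_add_one K)
  linarith [min_le_left (ε / 2) (1 / 3)]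

theorem theorem3p1_general {Ω : Type*} [MeasurableSpace Ω] {P : Measure Ω} {V : ThresholdModel}
    {q : ℝ → ℝ} (hq : HasCompactSupport q) {d L : List ℕ → Ω → ℕ} {X : List ℕ → Ω → ℝ}
    (hM : IsThresholdVoting P V q d L X) {a b : ℝ} (ha : 0 ≤ a) (hab : a < b)
    (hne : ∀ u ∈ Set.Ioo a b, V.nonlinearity u ≠ 0) {A B : ℕ → EReal}
    (hA : ∀ n, IsQuantile (P.map (voteOutcome d L X n)) a (A n))
    (hB : ∀ n, IsQuantile (P.map (voteOutcome d L X n)) b (B n)) :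
    (∀ n, P {ω | voteOutcome d L X n ω ∈ realIcc (A n) (B n)} ≠ 0) ∧
    ∀ m : ℕ → ℝ,
      (∀ n, IsQuantile ((P.map (voteOutcome d L X n))[|realIcc (A n) (B n)])
        (1 / 2) (m n : EReal)) →
      IsTightMeasureSet (Set.range fun n =>
        ((P.map (voteOutcome d L X n))[|realIcc (A n) (B n)]).map fun x => x - m n) := by
  have := hM.isProbabilityMeasure_map_outcome
  have := hM.nullSingletonClass_map_outcome_succ
  refine ⟨fun n => ?_, fun m hm => isTightMeasureSet_range_of_succ ?_⟩
  · have hpos := (hA n).measure_realIcc_ne_zero ha hab (hB n)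
    rwa [Measure.map_apply (hM.measurable_outcome n) (measurableSet_realIcc _ _)] at hpos
  · refine isTightMeasureSet_range_cond_realIcc_map_sub ha hab (fun η hη => ?_)
      (fun n => hA (n + 1)) (fun n => hB (n + 1)) fun n => hm (n + 1)
    obtain ⟨K, hK⟩ := hM.exists_climb hq (a := a + η) (b := b - η) fun u hu =>
      hne u ⟨by linarith [hu.1], by linarith [hu.2]⟩
    exact ⟨K, fun n => hK (n + 1)⟩

theorem notMem_range_of_mem_Ioo_castSucc_succ {N : ℕ} {β : Type*} [Preorder β]
    {α : Fin (N + 1) → β} (hα : StrictMono α) {s : Fin N} {u : β}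
    (hu : u ∈ Set.Ioo (α s.castSucc) (α s.succ)) : u ∉ Set.range α := by
  rintro ⟨j, rfl⟩
  exact (Fin.castSucc_lt_iff_succ_le.1 (hα.lt_iff_lt.1 hu.1)).not_gt (hα.lt_iff_lt.1 hu.2)

theorem theorem3p1
    {Ω : Type*} [MeasurableSpace Ω] (P : Measure Ω) [IsProbabilityMeasure P]
    (V : ThresholdModel) (q : ℝ → ℝ) (hq : IsJumpDensity q)
    (d L : List ℕ → Ω → ℕ) (X : List ℕ → Ω → ℝ) (hM : IsThresholdVoting P V q d L X)
    (hf : V.nonlinearity ≠ 0)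
    (α : Fin (V.numZeros + 2) → ℝ) (hα : StrictMono α)
    (hzeros : Set.range α = {u : ℝ | u ∈ Set.Icc (0 : ℝ) 1 ∧ V.nonlinearity u = 0})
    (Q : Fin (V.numZeros + 2) → ℕ → EReal)
    (hQ : ∀ s n, IsQuantile (P.map (voteOutcome d L X n)) (α s) (Q s n))
    (s : Fin (V.numZeros + 1)) :
    (∀ n, P {ω | voteOutcome d L X n ω ∈ realIcc (Q s.castSucc n) (Q s.succ n)} ≠ 0) ∧
    ∀ m : ℕ → ℝ,
      (∀ n, IsQuantile ((P.map (voteOutcome d L X n))[|realIcc (Q s.castSucc n) (Q s.succ n)])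
        (1 / 2) (m n : EReal)) →
      IsTightMeasureSet (Set.range fun n =>
        ((P.map (voteOutcome d L X n))[|realIcc (Q s.castSucc n) (Q s.succ n)]).map
          fun x => x - m n) := by
  have hmem (j) : α j ∈ Set.Icc (0 : ℝ) 1 := (hzeros.subset ⟨j, rfl⟩).1
  exact theorem3p1_general hq.hasCompactSupport hM (hmem _).1 (hα s.castSucc_lt_succ)
    (fun u hu hfu => notMem_range_of_mem_Ioo_castSucc_succ hα hu <|
      hzeros.superset ⟨⟨(hmem _).1.trans hu.1.le, hu.2.le.trans (hmem _).2⟩, hfu⟩)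
    (hQ s.castSucc) (hQ s.succ)
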